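/- **Setting.** Let $\mathcal L$ be a geometric lattice, i.e. a finite, atomistic, upper semimodular lattice, with least element $\hat 0$ and greatest element $\hat 1$. Let $\Delta(\mathcal L)$ be the order complex of $\mathcal L\setminus\{\hat 0,\hat 1\}$ (its simplices are the non-empty chains). Let $\mathcal I$ be the set of irreducible elements: those $X>\hat 0$ for which $[\hat 0,X]$ is not isomorphic to a product of two posets with more than one element each. For $X\in\mathcal L$ let $F(X)=\max\{Y\in\mathcal I : Y\le X\}$ be its set of factors. Let $\mathcal N(\mathcal L,\mathcal I)$ be the reduced minimal nested set complex: its simplices are the non-empty sets $S\subseteq\mathcal I\setminus\{\hat 1\}$ such that the join of any two or more pairwise incomparable elements of $S$ does not belong to $\mathcal I\cup\{\hat 1\}$. (If $\hat 1$ is irreducible, then $\mathcal I\cup\{\hat 1\}=\mathcal I$.) For a simplex $\sigma$ of an abstract simplicial complex $K$ and a new vertex $v$, the stellar subdivision $\mathrm{st}(K,\sigma)$ has as simplices the $\tau\in K$ with $\sigma\not\subseteq\tau$, and the sets $\tau\cup\{v\}$ with $\sigma\not\subseteq\tau$ and $\tau\cup\sigma\in K$ ($\tau=\emptyset$ allowed);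 its geometric realization is identified with that of $K$ by the map that is linear on simplices, sends $v$ to the barycenter of $\sigma$ and fixes all other vertices. **Proposition.** Let $X_1,\dots,X_m$ be any listing without repetition of the elements of $\mathcal L\setminus(\mathcal I\cup\{\hat 0,\hat 1\})$ in which no element precedes a larger one. Starting from $\mathcal N(\mathcal L,\mathcal I)$, successive stellar subdivisions in the simplices $F(X_1),\dots,F(X_m)$, with new vertices $X_1,\dots,X_m$, yield $\Delta(\mathcal L)$; in particular, at each step $F(X_i)$ is a simplex and $X_i$ is not a vertex of the complex reached so far. Moreover, for every maximal simplex $c:\ c_1<\dots<c_{r-1}$ of $\Delta(\mathcal L)$, the set $$F(c_1)\cup F(c_2)\cup\dots\cup F(c_{r-1})$$ is a maximal simplex of $\mathcal N(\mathcal L,\mathcal I)$, and it is the simplex supporting $c$: under the resulting identification of the realization of $\Delta(\mathcal L)$ with that of $\mathcal N(\mathcal L,\mathcal I)$, it is the smallest simplex of $\mathcal N(\mathcal L,\mathcal I)$ whose realization contains the realization of $c$. -/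

import Mathlib

namespace NestedSets

/-! ### Simplicial complexes, stellar subdivisions, supports -/

section Complexes

variable {V : Type*}

/-- A maximal simplex of an abstract simplicial complex. -/
def IsMaximalSimplex (K : PreAbstractSimplicialComplex V) (s : Finset V) : Prop :=
  Maximal (fun t => t ∈ K.faces) s

/-- The stellar subdivision of `K` in the simplex `σ`, with new vertex `v`: the simplices containing
`σ` are removed, and the simplices `τ ∪ {v}` are added, for those `τ` (possibly empty) which
do not contain `σ` but for which `τ ∪ σ` is a simplex of `K`. -/
def stellar [DecidableEq V] (K : PreAbstractSimplicialComplex V) (σ : Finset V) (v : V) :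
    PreAbstractSimplicialComplex V where
  faces := {ρ | ρ ∈ K.faces ∧ ¬ σ ⊆ ρ} ∪
    {ρ | ∃ τ : Finset V, ρ = insert v τ ∧ ¬ σ ⊆ τ ∧ τ ∪ σ ∈ K.faces}
  isRelLowerSet_faces := by
    rintro ρ (⟨hρ, hσ⟩ | ⟨τ, rfl, hσ, hτ⟩)
    · exact ⟨(K.isRelLowerSet_faces hρ).1, fun s hs hne =>
        Or.inl ⟨(K.isRelLowerSet_faces hρ).2 hs hne, fun h => hσ (h.trans hs)⟩⟩
    · refine ⟨Finset.insert_nonempty _ _, fun s (hs : s ⊆ insert v τ) hne => ?_⟩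
      by_cases hv : v ∈ s
      · have hsub : s.erase v ⊆ τ := by
          intro x hx
          have := hs (Finset.mem_of_mem_erase hx)
          exact (Finset.mem_insert.1 this).resolve_left (Finset.ne_of_mem_erase hx)
        have hne' : σ.Nonempty := by
          rw [Finset.nonempty_iff_ne_empty]
          rintro rfl
          exact hσ (Finset.empty_subset _)
        refine Or.inr ⟨s.erase v, (Finset.insert_erase hv).symm, fun h => hσ (h.trans hsub), ?_⟩
        exact (K.isRelLowerSet_faces hτ).2 (Finset.union_subset_union_left hsub)
          (hne'.mono Finset.subset_union_right)
      · have hsub : s ⊆ τ := by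
          intro x hx
          refine (Finset.mem_insert.1 (hs hx)).resolve_left ?_
          rintro rfl
          exact hv hx
        exact Or.inl ⟨(K.isRelLowerSet_faces hτ).2 (hsub.trans Finset.subset_union_left) hne,
          fun h => hσ (h.trans hsub)⟩

/-- `IsStellarSequence K l K'`: starting from `K`, one obtains `K'` by performing successively the
stellar subdivisions in `σ` with new vertex `v`, for the entries `(σ, v)` of the list `l`; each
`σ` is required to be a simplex, and each `v` not to be a vertex, of the complex reached so far. -/
inductive IsStellarSequence [DecidableEq V] :
    PreAbstractSimplicialComplex V → List (Finset V × V) → PreAbstractSimplicialComplex V → Prop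
  | nil (K : PreAbstractSimplicialComplex V) : IsStellarSequence K [] K
  | cons (K K' : PreAbstractSimplicialComplex V) (σ : Finset V) (v : V) (l : List (Finset V × V))
      (hσ : σ ∈ K.faces) (hv : {v} ∉ K.faces) (h : IsStellarSequence (stellar K σ v) l K') :
      IsStellarSequence K ((σ, v) :: l) K'

/-- The closed geometric simplex spanned by `s`. The geometric realization of a complex on the
vertex type `V` is the union of these in `V →₀ ℝ`, over its simplices `s`. -/
def geomSimplex (s : Finset V) : Set (V →₀ ℝ) :=
  convexHull ℝ ((fun v => Finsupp.single v (1 : ℝ)) '' (s : Set V))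

/-- The barycenter of the geometric simplex spanned by `s`. -/
noncomputable def barycenter (s : Finset V) : V →₀ ℝ :=
  ∑ u ∈ s, Finsupp.single u ((s.card : ℝ)⁻¹)

/-- The linear map which restricts to the canonical homeomorphism from the realization of
`stellar K σ v` to that of `K`: it sends `v` to the barycenter of `σ` and fixes all other
vertices. -/
noncomputable def stellarMap [DecidableEq V] (σ : Finset V) (v : V) :
    (V →₀ ℝ) →ₗ[ℝ] (V →₀ ℝ) :=
  Finsupp.linearCombination ℝ
    (fun w => if w = v then barycenter σ else Finsupp.single w (1 : ℝ))

/-- The composite of the maps `stellarMap` along a sequence of stellar subdivisions leading from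
`K` to `K'`; it maps the realization of `K'` to that of `K`. -/
noncomputable def subdivisionMap [DecidableEq V] :
    List (Finset V × V) → ((V →₀ ℝ) →ₗ[ℝ] (V →₀ ℝ))
  | [] => LinearMap.id
  | (σ, v) :: l => (stellarMap σ v).comp (subdivisionMap l)

/-- `s` is the simplex of `K` supporting the simplex `c` of a subdivision of `K`, where `f` identifies
the realization of the subdivision with that of `K`: the smallest simplex of `K` whose
realization contains that of `c`. -/
def IsSupportSimplex (K : PreAbstractSimplicialComplex V) (f : (V →₀ ℝ) →ₗ[ℝ] (V →₀ ℝ))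
    (c s : Finset V) : Prop :=
  IsLeast {t : Finset V | t ∈ K.faces ∧ f '' geomSimplex c ⊆ geomSimplex t} s

end Complexes

/-! ### Order complexes, irreducible elements, nested sets -/

section Lattices

universe u

variable (L : Type u) [Lattice L] [BoundedOrder L]

/-- The order complex of the proper part of `L`: its simplices are the non-empty finite chains of
elements different from `⊥` and `⊤`. -/
def orderComplex : PreAbstractSimplicialComplex L where
  faces := {s | s.Nonempty ∧ IsChain (· ≤ ·) (s : Set L) ∧ ∀ x ∈ s, x ≠ ⊥ ∧ x ≠ ⊤}
  isRelLowerSet_faces := by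
    rintro s ⟨hne, hc, hp⟩
    exact ⟨hne, fun t hts ht => ⟨ht, hc.mono (Finset.coe_subset.2 hts), fun x hx => hp x (hts hx)⟩⟩

/-- The irreducible elements of `L`: those `x > ⊥` whose lower interval `[⊥, x]` is not isomorphic
to a product of two partially ordered sets having more than one element each. -/
def irreducibles : Set L :=
  {x | x ≠ ⊥ ∧ ∀ (A B : Type u) [PartialOrder A] [PartialOrder B],
    Nonempty (Set.Iic x ≃o A × B) → Subsingleton A ∨ Subsingleton B}

variable {L}

open scoped Classical in
/-- The set of factors of `x` with respect to `G`: the maximal elements of `G` below `x`. -/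
noncomputable def factors [Fintype L] (G : Set L) (x : L) : Finset L :=
  Finset.univ.filter (fun y => Maximal (fun z => z ∈ G ∧ z ≤ x) y)

/-- `G`-nested sets: subsets of `G` for which the join of any two or more pairwise
incomparable elements does not belong to `G`. -/
def IsNested (G : Set L) (S : Finset L) : Prop :=
  (S : Set L) ⊆ G ∧
    ∀ T ⊆ S, 2 ≤ T.card → IsAntichain (· ≤ ·) (T : Set L) → T.sup id ∉ G

/-- The reduced nested set complex of `L` with respect to a building set `G` containing `⊤`: its
simplices are the non-empty `G`-nested sets which do not contain `⊤`. -/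
def reducedNestedComplex (G : Set L) : PreAbstractSimplicialComplex L where
  faces := {S | S.Nonempty ∧ IsNested G S ∧ ⊤ ∉ S}
  isRelLowerSet_faces := by
    rintro S ⟨hne, ⟨hG, hn⟩, htop⟩
    exact ⟨hne, fun S' hS' hne' => ⟨hne',
      ⟨(Finset.coe_subset.2 hS').trans hG, fun T hT => hn T (hT.trans hS')⟩,
      fun h => htop (hS' h)⟩⟩

end Lattices

end NestedSets

/-! Let `G` be a building set and `x ∉ G`. A set of elements of `G` is nested if and only if every
join of some of its members which lies in `G` is already one of these members. For sets not
containing `x`, passing from `G` to `insert x G` thus only forbids joins equal to `x`, that is, sets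
containing all factors of `x`; and `insert x τ` becomes nested exactly when `τ` does not contain all
factors of `x` but remains nested after adding them. Hence the nested set complex of `insert x G` is
the stellar subdivision of that of `G` in the simplex of factors of `x`. Once all elements other
than `⊥` have been added, nested sets are chains.

When the elements outside a building set `B` are added from the top down, the factors of `x` at the
moment when `x` is added are still its factors with respect to `B`. So the vertex `x` is mapped to
the barycenter of `factors B x`, and the support of a chain is the union of the factors of its
elements. Its maximality goes back through the subdivisions one at a time.

The irreducible elements form a building set: if `[⊥, x]` is the product of `[⊥, a]` and `[⊥, b]`,
then every irreducible element below `x` lies below `a` or `b`, so the factors of `x` are those of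
`a` together with those of `b`. -/

namespace NestedSets

section Complexes

variable {V : Type*}

theorem barycenter_eq_sum_smul (s : Finset V) :
    barycenter s = ∑ u ∈ s, (s.card : ℝ)⁻¹ • Finsupp.single u (1 : ℝ) := by
  simp [barycenter]

theorem barycenter_singleton (v : V) : barycenter {v} = Finsupp.single v (1 : ℝ) := by
  simp [barycenter]

theorem support_barycenter (s : Finset V) : (barycenter s).support = s := by
  classical
  ext u
  have hcard : u ∈ s → s.card ≠ 0 := Finset.card_ne_zero_of_mem
  simpa [barycenter, Finsupp.finsetSum_apply, Finsupp.single_apply] using hcard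

theorem support_subset_of_mem_geomSimplex {t : Finset V} {p : V →₀ ℝ} (hp : p ∈ geomSimplex t) :
    p.support ⊆ t := by
  have hsub : geomSimplex t ⊆ (Finsupp.supported ℝ ℝ (t : Set V) : Set (V →₀ ℝ)) :=
    convexHull_min (Set.image_subset_iff.2 fun _ hv => Finsupp.single_mem_supported ℝ 1 hv)
      (Submodule.convex _)
  exact Finset.coe_subset.1 (hsub hp)

theorem barycenter_mem_geomSimplex_iff {s t : Finset V} (hs : s.Nonempty) :
    barycenter s ∈ geomSimplex t ↔ s ⊆ t := by
  refine ⟨fun h => support_barycenter s ▸ support_subset_of_mem_geomSimplex h, fun hst => ?_⟩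
  have hcard : (s.card : ℝ) ≠ 0 := Nat.cast_ne_zero.2 hs.card_ne_zero
  rw [barycenter_eq_sum_smul]
  exact (convex_convexHull ℝ _).sum_mem (fun _ _ => by positivity) (by simp [hcard])
    fun u hu => subset_convexHull ℝ _ ⟨u, hst hu, rfl⟩

theorem image_geomSimplex_subset_iff (f : (V →₀ ℝ) →ₗ[ℝ] (V →₀ ℝ)) (c t : Finset V) :
    f '' geomSimplex c ⊆ geomSimplex t ↔ ∀ x ∈ c, f (Finsupp.single x 1) ∈ geomSimplex t := by
  simp only [geomSimplex, LinearMap.image_convexHull, (convex_convexHull ℝ _).convexHull_subset_iff,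
    Set.image_image, Set.image_subset_iff]
  rfl

theorem notMem_of_mem_faces {K : PreAbstractSimplicialComplex V} {v : V} {s : Finset V}
    (hv : {v} ∉ K.faces) (hs : s ∈ K.faces) : v ∉ s := fun hvs =>
  hv (K.isRelLowerSet_faces.mem_of_le hs (Finset.singleton_subset_iff.2 hvs)
    (Finset.singleton_nonempty v))

variable [DecidableEq V]

theorem isSupportSimplex_biUnion {K : PreAbstractSimplicialComplex V}
    {f : (V →₀ ℝ) →ₗ[ℝ] (V →₀ ℝ)} {F : V → Finset V} {c : Finset V}
    (hf : ∀ x ∈ c, f (Finsupp.single x 1) = barycenter (F x)) (hF : ∀ x ∈ c, (F x).Nonempty)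
    (hK : c.biUnion F ∈ K.faces) : IsSupportSimplex K f c (c.biUnion F) := by
  have hiff (t : Finset V) : f '' geomSimplex c ⊆ geomSimplex t ↔ c.biUnion F ⊆ t := by
    rw [image_geomSimplex_subset_iff, Finset.biUnion_subset]
    exact forall₂_congr fun x hx => by rw [hf x hx, barycenter_mem_geomSimplex_iff (hF x hx)]
  exact ⟨⟨hK, (hiff _).2 subset_rfl⟩, fun t ht => (hiff t).1 ht.2⟩

theorem stellarMap_single (σ : Finset V) (v w : V) :
    stellarMap σ v (Finsupp.single w 1) =
      if w = v then barycenter σ else Finsupp.single w (1 : ℝ) := by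
  simp [stellarMap]

theorem stellarMap_barycenter_of_notMem (σ : Finset V) {v : V} {s : Finset V} (hv : v ∉ s) :
    stellarMap σ v (barycenter s) = barycenter s := by
  rw [barycenter_eq_sum_smul, map_sum]
  refine Finset.sum_congr rfl fun u hu => ?_
  rw [map_smul, stellarMap_single, if_neg (ne_of_mem_of_not_mem hu hv)]

/-- The carrier of the vertex `v` under subdivisions in the simplices `F x` with new vertices `x`,
for `x` in `l`: the simplex of the original complex having the image of `v` in its interior. This
is correct when no new vertex belongs to a simplex `F x`. -/
def vertexCarrier (F : V → Finset V) (l : List V) (v : V) : Finset V :=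
  if v ∈ l then F v else {v}

theorem vertexCarrier_cons (F : V → Finset V) (x : V) (l : List V) (v : V) :
    vertexCarrier F (x :: l) v = if v = x then F x else vertexCarrier F l v := by
  unfold vertexCarrier
  grind

theorem notMem_vertexCarrier {F : V → Finset V} {l : List V} {x v : V}
    (hx : ∀ y ∈ l, x ∉ F y) (hxv : v = x → x ∈ l) : x ∉ vertexCarrier F l v := by
  unfold vertexCarrier
  grind

theorem subdivisionMap_single {F : V → Finset V} {l : List V} (h : ∀ x ∈ l, ∀ y ∈ l, x ∉ F y)
    (v : V) :
    subdivisionMap (l.map fun x => (F x, x)) (Finsupp.single v 1) =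
      barycenter (vertexCarrier F l v) := by
  induction l with
  | nil => simp [subdivisionMap, vertexCarrier, barycenter_singleton]
  | cons x l ih =>
    simp only [List.forall_mem_cons] at h
    rw [List.map_cons, subdivisionMap, LinearMap.comp_apply, ih fun y hy => (h.2 y hy).2]
    by_cases hxv : v = x → x ∈ l
    · rw [stellarMap_barycenter_of_notMem _ (notMem_vertexCarrier h.1.2 hxv), vertexCarrier_cons]
      unfold vertexCarrier
      grind
    · obtain ⟨rfl, hvl⟩ := Classical.not_imp.1 hxv
      rw [vertexCarrier, if_neg hvl, barycenter_singleton, stellarMap_single, if_pos rfl,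
        vertexCarrier, if_pos List.mem_cons_self]

section Stellar

variable {K K' : PreAbstractSimplicialComplex V} {σ τ s : Finset V} {v : V}

theorem mem_stellar_faces_of_notMem (hvs : v ∉ s) :
    s ∈ (stellar K σ v).faces ↔ s ∈ K.faces ∧ ¬ σ ⊆ s := by
  refine ⟨?_, Or.inl⟩
  rintro (h | ⟨τ, rfl, -, -⟩)
  · exact h
  · exact absurd (Finset.mem_insert_self v τ) hvs

theorem insert_mem_stellar_faces (hv : {v} ∉ K.faces) (hvτ : v ∉ τ) :
    insert v τ ∈ (stellar K σ v).faces ↔ ¬ σ ⊆ τ ∧ τ ∪ σ ∈ K.faces := by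
  refine ⟨?_, fun h => Or.inr ⟨τ, rfl, h⟩⟩
  rintro (⟨h, -⟩ | ⟨τ', hττ', h, hface⟩)
  · exact absurd (Finset.mem_insert_self v τ) (notMem_of_mem_faces hv h)
  · have hvτ' : v ∉ τ' := fun h => notMem_of_mem_faces hv hface (Finset.mem_union_left _ h)
    rw [← Finset.erase_insert hvτ, hττ', Finset.erase_insert hvτ']
    exact ⟨h, hface⟩

theorem IsMaximalSimplex.of_stellar (hs : IsMaximalSimplex (stellar K σ v) s) (hvs : v ∉ s) :
    IsMaximalSimplex K s := by
  obtain ⟨hsK, hσs⟩ := (mem_stellar_faces_of_notMem hvs).1 hs.prop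
  refine ⟨hsK, fun t ht (hst : s ⊆ t) => ?_⟩
  by_cases hσt : σ ⊆ t
  · have hface : insert v s ∈ (stellar K σ v).faces :=
      Or.inr ⟨s, rfl, hσs, K.isRelLowerSet_faces.mem_of_le ht (Finset.union_subset hst hσt)
        ((K.isRelLowerSet_faces hsK).1.mono Finset.subset_union_left)⟩
    exact absurd (hs.le_of_ge hface (Finset.subset_insert v s) (Finset.mem_insert_self v s)) hvs
  · exact hs.le_of_ge (Or.inl ⟨ht, hσt⟩) hst

theorem IsMaximalSimplex.union_of_stellar (hv : {v} ∉ K.faces) (hvτ : v ∉ τ)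
    (hs : IsMaximalSimplex (stellar K σ v) (insert v τ)) : IsMaximalSimplex K (τ ∪ σ) := by
  obtain ⟨hστ, hface⟩ := (insert_mem_stellar_faces hv hvτ).1 hs.prop
  refine ⟨hface, fun t ht (hst : τ ∪ σ ⊆ t) w hwt => ?_⟩
  by_contra hw
  obtain ⟨hwτ, hwσ⟩ := not_or.1 (Finset.mem_union.not.1 hw)
  have hface' : insert v (insert w τ) ∈ (stellar K σ v).faces := by
    refine Or.inr ⟨_, rfl, fun h => hστ ((Finset.subset_insert_iff_of_notMem hwσ).1 h),
      K.isRelLowerSet_faces.mem_of_le ht ?_ ⟨w, by simp⟩⟩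
    rw [Finset.insert_union]
    exact Finset.insert_subset hwt hst
  have hw' : w ∈ insert v τ :=
    hs.le_of_ge hface' (Finset.insert_subset_insert v (Finset.subset_insert w τ)) (by simp)
  have hwv : w ≠ v := ne_of_mem_of_not_mem hwt (notMem_of_mem_faces hv ht)
  exact hwτ (Finset.mem_of_mem_insert_of_ne hw' hwv)

theorem IsStellarSequence.isMaximalSimplex_biUnion {F : V → Finset V} {l : List V}
    (hK : IsStellarSequence K (l.map fun x => (F x, x)) K') (hF : ∀ x ∈ l, ∀ y ∈ l, x ∉ F y)
    (hs : IsMaximalSimplex K' s) : IsMaximalSimplex K (s.biUnion (vertexCarrier F l)) := by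
  induction l generalizing K with
  | nil =>
    cases hK
    have hcarrier : s.biUnion (vertexCarrier F []) = s := by ext; simp [vertexCarrier]
    rwa [hcarrier]
  | cons x l ih =>
    obtain - | ⟨_, _, _, _, _, -, hx, hK⟩ := hK
    simp only [List.forall_mem_cons] at hF
    have hmax := ih hK fun y hy => (hF.2 y hy).2
    by_cases hxs : x ∈ s ∧ x ∉ l
    · obtain ⟨τ, hxτ, rfl⟩ : ∃ τ, x ∉ τ ∧ insert x τ = s :=
        ⟨s.erase x, Finset.notMem_erase x s, Finset.insert_erase hxs.1⟩
      have hxC : x ∉ τ.biUnion (vertexCarrier F l) := by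
        simp only [Finset.mem_biUnion, not_exists, not_and]
        exact fun v hv => notMem_vertexCarrier hF.1.2 fun h => absurd (h ▸ hv) hxτ
      rw [Finset.biUnion_insert, vertexCarrier, if_neg hxs.2, Finset.singleton_union] at hmax
      convert hmax.union_of_stellar hx hxC using 1
      rw [Finset.biUnion_insert, vertexCarrier_cons, if_pos rfl, Finset.union_comm]
      congr 1
      refine Finset.biUnion_congr rfl fun v hv => ?_
      rw [vertexCarrier_cons, if_neg (ne_of_mem_of_not_mem hv hxτ)]
    · have hcongr : s.biUnion (vertexCarrier F (x :: l)) = s.biUnion (vertexCarrier F l) := by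
        refine Finset.biUnion_congr rfl fun v hv => ?_
        unfold vertexCarrier
        grind
      rw [hcongr]
      refine hmax.of_stellar ?_
      simp only [Finset.mem_biUnion, not_exists, not_and]
      exact fun v hv => notMem_vertexCarrier hF.1.2 fun h => by grind

end Stellar

end Complexes

section Factors

variable {L : Type*} [Lattice L] [Fintype L] {G : Set L} {x y z : L}

theorem mem_factors : y ∈ factors G x ↔ Maximal (fun z => z ∈ G ∧ z ≤ x) y := by
  simp [factors]

theorem mem_of_mem_factors (hy : y ∈ factors G x) : y ∈ G :=
  (mem_factors.1 hy).prop.1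

theorem le_of_mem_factors (hy : y ∈ factors G x) : y ≤ x :=
  (mem_factors.1 hy).prop.2

theorem eq_of_mem_factors_of_le (hy : y ∈ factors G x) (hz : z ∈ G) (hzx : z ≤ x) (hyz : y ≤ z) :
    y = z :=
  (mem_factors.1 hy).eq_of_le ⟨hz, hzx⟩ hyz

theorem mem_factors_of_le {a : L} (hy : y ∈ factors G x) (hax : a ≤ x) (hya : y ≤ a) :
    y ∈ factors G a :=
  mem_factors.2 ⟨⟨mem_of_mem_factors hy, hya⟩, fun _ hz hyz =>
    (eq_of_mem_factors_of_le hy hz.1 (hz.2.trans hax) hyz).ge⟩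

theorem exists_factor_ge (hz : z ∈ G) (hzx : z ≤ x) : ∃ y ∈ factors G x, z ≤ y := by
  obtain ⟨y, hzy, hy⟩ := Finite.exists_le_maximal (p := fun z => z ∈ G ∧ z ≤ x) ⟨hz, hzx⟩
  exact ⟨y, mem_factors.2 hy, hzy⟩

theorem factors_eq_singleton (hx : x ∈ G) : factors G x = {x} := by
  refine Finset.eq_singleton_iff_unique_mem.2
    ⟨mem_factors.2 ⟨⟨hx, le_rfl⟩, fun _ hz _ => hz.2⟩, fun y hy => ?_⟩
  exact eq_of_mem_factors_of_le hy hx le_rfl (le_of_mem_factors hy)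

theorem factors_eq_of_subset {B : Set L} (hBG : B ⊆ G) (hup : ∀ z ∈ G \ B, Set.Ici z ⊆ G)
    (hxG : x ∉ G) : factors G x = factors B x := by
  have hiff (z : L) : z ∈ G ∧ z ≤ x ↔ z ∈ B ∧ z ≤ x :=
    and_congr_left fun hzx => ⟨fun hz => by_contra fun hzB => hxG (hup z ⟨hz, hzB⟩ hzx), (hBG ·)⟩
  ext y
  simp only [mem_factors, hiff]

theorem top_notMem_factors [BoundedOrder L] (hxG : x ∉ G) : ⊤ ∉ factors G x := fun h =>
  hxG (top_le_iff.1 (le_of_mem_factors h) ▸ mem_of_mem_factors h)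

theorem sup_factors_le [BoundedOrder L] : (factors G x).sup id ≤ x :=
  Finset.sup_le fun _ => le_of_mem_factors

theorem sup_factors_mono [BoundedOrder L] (hxy : x ≤ y) :
    (factors G x).sup id ≤ (factors G y).sup id := by
  refine Finset.sup_le fun z hz => ?_
  obtain ⟨w, hw, hzw⟩ := exists_factor_ge (mem_of_mem_factors hz) ((le_of_mem_factors hz).trans hxy)
  exact hzw.trans (Finset.le_sup (f := id) hw)

end Factors

section Nested

variable {L : Type*} [Lattice L] [BoundedOrder L] {G : Set L} {S : Finset L}

theorem isNested_iff_sup_mem (hbot : ⊥ ∉ G) :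
    IsNested G S ↔ (S : Set L) ⊆ G ∧ ∀ T ⊆ S, T.sup id ∈ G → T.sup id ∈ T := by
  classical
  refine and_congr_right fun _ => ⟨fun h T hTS hT => ?_, fun h T hTS hcard hanti hT => ?_⟩
  · let M := T.filter (Maximal (· ∈ T))
    have hsup : M.sup id = T.sup id := by
      refine le_antisymm (Finset.sup_mono (Finset.filter_subset _ T)) (Finset.sup_le fun t ht => ?_)
      obtain ⟨m, htm, hm⟩ := T.exists_le_maximal ht
      exact htm.trans (Finset.le_sup (f := id) (Finset.mem_filter.2 ⟨hm.prop, hm⟩))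
    have hanti : IsAntichain (· ≤ ·) (M : Set L) := fun a ha b hb hne hab =>
      hne ((Finset.mem_filter.1 ha).2.eq_of_le (Finset.mem_filter.1 hb).1 hab)
    have hM : M.Nonempty := by
      refine Finset.nonempty_iff_ne_empty.2 fun hM => hbot ?_
      simpa only [← hsup, hM, Finset.sup_empty] using hT
    have hcard : ¬ 2 ≤ M.card := fun hcard =>
      h M ((Finset.filter_subset _ T).trans hTS) hcard hanti (hsup ▸ hT)
    obtain ⟨m, hm⟩ := Finset.card_eq_one.1 (show M.card = 1 by grind [hM.card_pos])
    rw [← hsup, hm, Finset.sup_singleton]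
    exact Finset.filter_subset _ T (hm ▸ Finset.mem_singleton_self m : m ∈ M)
  · obtain ⟨t, ht, hne⟩ := Finset.exists_mem_ne hcard (T.sup id)
    exact hanti ht (h T hTS hT) hne (Finset.le_sup (f := id) ht)

theorem IsNested.sup_mem {T : Finset L} (hS : IsNested G S) (hbot : ⊥ ∉ G) (hTS : T ⊆ S)
    (hT : T.sup id ∈ G) : T.sup id ∈ T :=
  ((isNested_iff_sup_mem hbot).1 hS).2 T hTS hT

theorem IsNested.mono {S' : Finset L} (hS : IsNested G S) (h : S' ⊆ S) : IsNested G S' :=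
  ⟨(Finset.coe_subset.2 h).trans hS.1, fun T hT => hS.2 T (hT.trans h)⟩

theorem singleton_notMem_reducedNestedComplex_faces {x : L} (hxG : x ∉ G) :
    {x} ∉ (reducedNestedComplex G).faces := fun h =>
  hxG (h.2.1.1 (Finset.mem_coe.2 (Finset.mem_singleton_self x)))

variable [Fintype L] {x y w : L}

theorem isNested_factors (hbot : ⊥ ∉ G) : IsNested G (factors G x) := by
  refine (isNested_iff_sup_mem hbot).2 ⟨fun _ => mem_of_mem_factors, fun T hT hsup => ?_⟩
  obtain ⟨t, ht⟩ : T.Nonempty := by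
    refine Finset.nonempty_iff_ne_empty.2 fun h => hbot ?_
    simpa only [h, Finset.sup_empty] using hsup
  have hle : T.sup id ≤ x := Finset.sup_le fun s hs => le_of_mem_factors (hT hs)
  rwa [← eq_of_mem_factors_of_le (hT ht) hsup hle (Finset.le_sup (f := id) ht)]

/-- A weak form of the building sets of Feichtner and Kozlov: they require the join map from
`∏ y ∈ factors G x, [⊥, y]` to `[⊥, x]` to be an isomorphism for every `x`, whereas here the top of
the product has image `x` and is the only element with this image. -/
structure IsWeakBuildingSet (G : Set L) : Prop where
  bot_notMem : ⊥ ∉ G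
  sup_factors (x : L) : (factors G x).sup id = x
  eq_of_sup_factors_eq {f : L → L} (hf : ∀ y, f y ≤ y) {x : L} (h : (factors G x).sup f = x) :
    ∀ y ∈ factors G x, f y = y

namespace IsWeakBuildingSet

theorem factors_nonempty (hG : IsWeakBuildingSet G) (hx : x ≠ ⊥) : (factors G x).Nonempty := by
  refine Finset.nonempty_iff_ne_empty.2 fun h => hx ?_
  rw [← hG.sup_factors x, h, Finset.sup_empty]

theorem sup_filter_le [DecidableLE L] (hG : IsWeakBuildingSet G) {T : Finset L}
    (hT : (T : Set L) ⊆ G) (hy : y ∈ factors G (T.sup id)) : (T.filter (· ≤ y)).sup id = y := by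
  refine hG.eq_of_sup_factors_eq (f := fun y => (T.filter (· ≤ y)).sup id) (x := T.sup id)
    (fun y => Finset.sup_le fun t ht => (Finset.mem_filter.1 ht).2) (le_antisymm ?_ ?_) y hy
  · exact Finset.sup_le fun y _ => Finset.sup_mono (Finset.filter_subset _ T)
  · refine Finset.sup_le fun t ht => ?_
    obtain ⟨y, hy, hty⟩ := exists_factor_ge (hT ht) (Finset.le_sup (f := id) ht)
    exact (Finset.le_sup (f := id) (Finset.mem_filter.2 ⟨ht, hty⟩)).trans
      (Finset.le_sup (f := fun y => (T.filter (· ≤ y)).sup id) hy)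

theorem exists_ge_of_le_sup (hG : IsWeakBuildingSet G) (hS : IsNested G S) {T : Finset L}
    (hTS : T ⊆ S) (hw : w ∈ G) (hwT : w ≤ T.sup id) : ∃ t ∈ T, w ≤ t := by
  classical
  obtain ⟨y, hy, hwy⟩ := exists_factor_ge hw hwT
  have hsup := hG.sup_filter_le ((Finset.coe_subset.2 hTS).trans hS.1) hy
  have hmem : y ∈ T.filter (· ≤ y) := by
    simpa only [hsup] using hS.sup_mem hG.bot_notMem ((Finset.filter_subset (· ≤ y) T).trans hTS)
      (hsup.symm ▸ mem_of_mem_factors hy)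
  exact ⟨y, Finset.filter_subset _ T hmem, hwy⟩

theorem factors_mem_faces (hG : IsWeakBuildingSet G) (hx : x ≠ ⊥) (hxG : x ∉ G) :
    factors G x ∈ (reducedNestedComplex G).faces :=
  ⟨hG.factors_nonempty hx, isNested_factors hG.bot_notMem, top_notMem_factors hxG⟩

theorem isNested_insert_iff_of_notMem (hG : IsWeakBuildingSet G) (hx : x ≠ ⊥) (hxG : x ∉ G)
    (hxS : x ∉ S) : IsNested (insert x G) S ↔ IsNested G S ∧ ¬ factors G x ⊆ S := by
  have hbot : ⊥ ∉ insert x G := Set.mem_insert_iff.not.2 (not_or.2 ⟨hx.symm, hG.bot_notMem⟩)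
  rw [isNested_iff_sup_mem hbot, isNested_iff_sup_mem hG.bot_notMem]
  refine ⟨fun ⟨hSG, hS⟩ => ⟨⟨(Set.subset_insert_iff_of_notMem hxS).1 hSG, fun T hT h =>
    hS T hT (Set.mem_insert_of_mem x h)⟩, fun hFS => ?_⟩, fun ⟨⟨hSG, hS⟩, hFS⟩ =>
    ⟨hSG.trans (Set.subset_insert x G), fun T hT h => h.elim (fun hTx => ?_) (hS T hT)⟩⟩
  · have hmem := hS _ hFS (by rw [hG.sup_factors]; exact Set.mem_insert x G)
    rw [hG.sup_factors] at hmem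
    exact hxG (mem_of_mem_factors hmem)
  · refine absurd (fun y hy => ?_) hFS
    have hTG : (T : Set L) ⊆ G := (Finset.coe_subset.2 hT).trans hSG
    obtain ⟨t, ht, hyt⟩ := hG.exists_ge_of_le_sup ((isNested_iff_sup_mem hG.bot_notMem).2 ⟨hSG, hS⟩)
      hT (mem_of_mem_factors hy) (hTx ▸ le_of_mem_factors hy)
    rw [eq_of_mem_factors_of_le hy (hTG ht) (hTx ▸ Finset.le_sup (f := id) ht) hyt]
    exact hT ht

variable [DecidableEq L]

theorem isNested_union_factors (hG : IsWeakBuildingSet G) (hG' : IsWeakBuildingSet (insert x G))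
    (hxS : x ∉ S) (hS : IsNested (insert x G) (insert x S)) :
    IsNested G (S ∪ factors G x) := by
  have hSG : (S : Set L) ⊆ G := fun s hs => (hS.1 (Finset.mem_insert_of_mem hs)).resolve_left
    (ne_of_mem_of_not_mem hs hxS)
  refine (isNested_iff_sup_mem hG.bot_notMem).2 ⟨fun z hz => (Finset.mem_union.1 hz).elim (hSG ·)
    mem_of_mem_factors, fun T hT hTG => ?_⟩
  have hTG' : T.sup id ∈ insert x G := Set.mem_insert_of_mem x hTG
  by_cases hTS : T ⊆ S
  · exact hS.sup_mem hG'.bot_notMem (hTS.trans (Finset.subset_insert x S)) hTG'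
  obtain ⟨y, hyT, hyS⟩ := Finset.not_subset.1 hTS
  have hy : y ∈ factors G x := (Finset.mem_union.1 (hT hyT)).resolve_left hyS
  have hle : T.sup id ≤ (insert x (T ∩ S)).sup id := by
    refine Finset.sup_le fun t ht => ?_
    rw [Finset.sup_insert]
    by_cases htS : t ∈ S
    · exact le_sup_of_le_right (Finset.le_sup (f := id) (Finset.mem_inter.2 ⟨ht, htS⟩))
    · exact le_sup_of_le_left (le_of_mem_factors ((Finset.mem_union.1 (hT ht)).resolve_left htS))
  obtain ⟨t, ht, hTt⟩ := hG'.exists_ge_of_le_sup hS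
    (Finset.insert_subset_insert x Finset.inter_subset_right) hTG' hle
  obtain rfl | ht := Finset.mem_insert.1 ht
  · rwa [← eq_of_mem_factors_of_le hy hTG hTt (Finset.le_sup (f := id) hyT)]
  · have htT := Finset.mem_of_mem_inter_left ht
    rwa [hTt.antisymm (Finset.le_sup (f := id) htT)]

theorem isNested_insert_of_union_factors (hG : IsWeakBuildingSet G)
    (hG' : IsWeakBuildingSet (insert x G)) (hxG : x ∉ G) (hFS : ¬ factors G x ⊆ S)
    (hS : IsNested G (S ∪ factors G x)) : IsNested (insert x G) (insert x S) := by
  have hSG : IsNested G S := hS.mono Finset.subset_union_left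
  have hx : x ≠ ⊥ := fun h => hG'.bot_notMem (h ▸ Set.mem_insert x G)
  refine (isNested_iff_sup_mem hG'.bot_notMem).2 ⟨?_, fun T hT hTG => ?_⟩
  · rw [Finset.coe_insert]
    exact Set.insert_subset_insert hSG.1
  by_cases hxT : x ∈ T
  · obtain hTx | hTG := hTG
    · rwa [hTx]
    have hsup : (T.erase x ∪ factors G x).sup id = T.sup id := by
      rw [Finset.sup_union, hG.sup_factors, sup_comm, ← id_eq x, ← Finset.sup_insert, id_eq,
        Finset.insert_erase hxT]
    have hmem := hS.sup_mem hG.bot_notMem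
      (Finset.union_subset_union_left (Finset.subset_insert_iff.1 hT)) (hsup.symm ▸ hTG)
    rw [hsup, Finset.mem_union] at hmem
    refine hmem.elim Finset.mem_of_mem_erase fun h => absurd ?_ hxG
    have hTx : T.sup id = x := (le_of_mem_factors h).antisymm (Finset.le_sup (f := id) hxT)
    rwa [← hTx]
  · have hxS : x ∉ S := fun h => hxG (hSG.1 h)
    exact ((hG.isNested_insert_iff_of_notMem hx hxG hxS).2 ⟨hSG, hFS⟩).sup_mem hG'.bot_notMem
      ((Finset.subset_insert_iff_of_notMem hxT).1 hT) hTG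

theorem isNested_insert_insert_iff (hG : IsWeakBuildingSet G)
    (hG' : IsWeakBuildingSet (insert x G)) (hxG : x ∉ G) (hxS : x ∉ S) :
    IsNested (insert x G) (insert x S) ↔ ¬ factors G x ⊆ S ∧ IsNested G (S ∪ factors G x) := by
  have hx : x ≠ ⊥ := fun h => hG'.bot_notMem (h ▸ Set.mem_insert x G)
  refine ⟨fun hS => ⟨?_, hG.isNested_union_factors hG' hxS hS⟩, fun h =>
    hG.isNested_insert_of_union_factors hG' hxG h.1 h.2⟩
  exact ((hG.isNested_insert_iff_of_notMem hx hxG hxS).1 (hS.mono (Finset.subset_insert x S))).2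

theorem stellar_reducedNestedComplex (hG : IsWeakBuildingSet G)
    (hG' : IsWeakBuildingSet (insert x G)) (hxG : x ∉ G) (hx : x ≠ ⊤) :
    stellar (reducedNestedComplex G) (factors G x) x = reducedNestedComplex (insert x G) := by
  have hbot : x ≠ ⊥ := fun h => hG'.bot_notMem (h ▸ Set.mem_insert x G)
  have htop := top_notMem_factors hxG
  ext S
  by_cases hxS : x ∈ S
  · obtain ⟨τ, hxτ, rfl⟩ : ∃ τ, x ∉ τ ∧ insert x τ = S :=
      ⟨S.erase x, Finset.notMem_erase x S, Finset.insert_erase hxS⟩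
    rw [insert_mem_stellar_faces (singleton_notMem_reducedNestedComplex_faces hxG) hxτ]
    change _ ∧ _ ∧ _ ∧ _ ↔ _ ∧ _ ∧ _
    rw [hG.isNested_insert_insert_iff hG' hxG hxτ, Finset.mem_union, Finset.mem_insert]
    have hne : (τ ∪ factors G x).Nonempty :=
      (hG.factors_nonempty hbot).mono Finset.subset_union_right
    grind [Finset.insert_nonempty x τ]
  · rw [mem_stellar_faces_of_notMem hxS]
    change (_ ∧ _ ∧ _) ∧ _ ↔ _ ∧ _ ∧ _
    rw [hG.isNested_insert_iff_of_notMem hbot hxG hxS]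
    tauto

end IsWeakBuildingSet

theorem IsWeakBuildingSet.of_subset {B : Set L} (hB : IsWeakBuildingSet B) (hBG : B ⊆ G)
    (hbot : ⊥ ∉ G) (hup : ∀ z ∈ G \ B, Set.Ici z ⊆ G) : IsWeakBuildingSet G where
  bot_notMem := hbot
  sup_factors x := by
    by_cases hx : x ∈ G
    · rw [factors_eq_singleton hx, Finset.sup_singleton, id_eq]
    · rw [factors_eq_of_subset hBG hup hx, hB.sup_factors]
  eq_of_sup_factors_eq {f} hf {x} h := by
    by_cases hx : x ∈ G
    · rw [factors_eq_singleton hx] at h ⊢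
      simpa only [Finset.mem_singleton, forall_eq, Finset.sup_singleton] using h
    · rw [factors_eq_of_subset hBG hup hx] at h ⊢
      exact hB.eq_of_sup_factors_eq hf h

end Nested

section Sequence

variable {L : Type*} [Lattice L] [BoundedOrder L]

theorem reducedNestedComplex_insert_top_compl_bot :
    reducedNestedComplex (insert ⊤ {⊥}ᶜ : Set L) = orderComplex L := by
  classical
  ext S
  refine and_congr_right fun _ => ⟨fun ⟨⟨hS, hnested⟩, htop⟩ => ?_, fun ⟨hchain, hS⟩ =>
    ⟨⟨fun x hx => Or.inr (hS x hx).1, fun T hT hcard hanti => ?_⟩, fun h => (hS ⊤ h).2 rfl⟩⟩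
  · have hproper (x) (hx : x ∈ S) : x ≠ ⊥ ∧ x ≠ ⊤ :=
      have hx_top : x ≠ ⊤ := ne_of_mem_of_not_mem hx htop
      ⟨(hS hx).resolve_left hx_top, hx_top⟩
    refine ⟨fun x hx y hy hne => ?_, hproper⟩
    by_contra! hxy
    refine hnested {x, y} (Finset.insert_subset hx (Finset.singleton_subset_iff.2 hy))
      (Finset.card_pair hne).ge ?_ (Or.inr ?_)
    · simp [isAntichain_insert, hxy]
    · simp [(hproper x hx).1]
  · have hsub := subsingleton_of_isChain_of_isAntichain (hchain.mono (Finset.coe_subset.2 hT)) hanti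
    have := Finset.card_le_one_iff_subsingleton.2 hsub
    omega

/-- The building set reached when the elements of `l` are the ones still to be added. -/
def stageBuildingSet (l : List L) : Set L :=
  insert ⊤ {x | x ≠ ⊥ ∧ x ∉ l}

theorem notMem_stageBuildingSet_cons {x : L} (l : List L) (hx : x ≠ ⊤) :
    x ∉ stageBuildingSet (x :: l) := by
  simp [stageBuildingSet, hx]

theorem insert_stageBuildingSet_cons {x : L} {l : List L} (hx : x ≠ ⊥) (hxl : x ∉ l) :
    insert x (stageBuildingSet (x :: l)) = stageBuildingSet l := by
  ext
  simp only [stageBuildingSet, Set.mem_insert_iff, Set.mem_ofPred_eq, List.mem_cons]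
  grind

/-- The possible lists of elements still to be added to the building set `B`, when they are added
in an order in which no element precedes a larger one. -/
structure IsPendingList (B : Set L) (l : List L) : Prop where
  ne_bot : ∀ x ∈ l, x ≠ ⊥
  ne_top : ∀ x ∈ l, x ≠ ⊤
  notMem : ∀ x ∈ l, x ∉ B
  mem_of_le : ∀ x ∈ l, ∀ z ≤ x, z ≠ ⊥ → z ∉ B → z ∈ l
  pairwise : l.Pairwise (¬ · ≤ ·)

namespace IsPendingList

variable {B : Set L} {x : L} {l : List L}

theorem of_mem_iff (hnodup : l.Nodup) (hmem : ∀ x, x ∈ l ↔ x ≠ ⊥ ∧ x ≠ ⊤ ∧ x ∉ B)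
    (horder : l.Pairwise (¬ · < ·)) : IsPendingList B l where
  ne_bot x hx := ((hmem x).1 hx).1
  ne_top x hx := ((hmem x).1 hx).2.1
  notMem x hx := ((hmem x).1 hx).2.2
  mem_of_le x hx z hzx hz hzB := (hmem z).2 ⟨hz, ne_top_of_le_ne_top ((hmem x).1 hx).2.1 hzx, hzB⟩
  pairwise := (hnodup.and horder).imp fun ⟨hne, hlt⟩ hle => hlt (hle.lt_of_ne hne)

theorem of_cons (h : IsPendingList B (x :: l)) : IsPendingList B l where
  ne_bot y hy := h.ne_bot y (List.mem_cons_of_mem x hy)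
  ne_top y hy := h.ne_top y (List.mem_cons_of_mem x hy)
  notMem y hy := h.notMem y (List.mem_cons_of_mem x hy)
  mem_of_le y hy z hzy hz hzB := by
    have hmem := h.mem_of_le y (List.mem_cons_of_mem x hy) z hzy hz hzB
    refine (List.mem_cons.1 hmem).resolve_left ?_
    rintro rfl
    exact List.rel_of_pairwise_cons h.pairwise hy hzy
  pairwise := h.pairwise.of_cons

theorem subset_stageBuildingSet (h : IsPendingList B l) (hbot : ⊥ ∉ B) :
    B ⊆ stageBuildingSet l := fun y hy =>
  Or.inr ⟨ne_of_mem_of_not_mem hy hbot, fun hyl => h.notMem y hyl hy⟩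

theorem Ici_subset_stageBuildingSet (h : IsPendingList B l) :
    ∀ z ∈ stageBuildingSet l \ B, Set.Ici z ⊆ stageBuildingSet l := by
  rintro z ⟨rfl | ⟨hz, hzl⟩, hzB⟩ w (hzw : _ ≤ w)
  · exact Or.inl (top_le_iff.1 hzw)
  · exact Or.inr ⟨ne_bot_of_le_ne_bot hz hzw, fun hwl => hzl (h.mem_of_le w hwl z hzw hz hzB)⟩

variable [Fintype L]

theorem isWeakBuildingSet_stageBuildingSet [Nontrivial L] (h : IsPendingList B l)
    (hB : IsWeakBuildingSet B) : IsWeakBuildingSet (stageBuildingSet l) :=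
  hB.of_subset (h.subset_stageBuildingSet hB.bot_notMem) (by simp [stageBuildingSet])
    h.Ici_subset_stageBuildingSet

theorem isStellarSequence [DecidableEq L] (h : IsPendingList B l) (hB : IsWeakBuildingSet B) :
    IsStellarSequence (reducedNestedComplex (stageBuildingSet l))
      (l.map fun x => (factors B x, x)) (orderComplex L) := by
  induction l with
  | nil =>
    have hstage : stageBuildingSet [] = (insert ⊤ {⊥}ᶜ : Set L) := by ext; simp [stageBuildingSet]
    rw [hstage, reducedNestedComplex_insert_top_compl_bot]
    exact .nil _
  | cons x l ih =>
    have hbot : x ≠ ⊥ := h.ne_bot x List.mem_cons_self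
    have htop : x ≠ ⊤ := h.ne_top x List.mem_cons_self
    have : Nontrivial L := ⟨x, ⊤, htop⟩
    have hxl : x ∉ l := fun hx => List.rel_of_pairwise_cons h.pairwise hx le_rfl
    have hxG := notMem_stageBuildingSet_cons l htop
    have hinsert := insert_stageBuildingSet_cons hbot hxl
    have hG := h.isWeakBuildingSet_stageBuildingSet hB
    have hG' := h.of_cons.isWeakBuildingSet_stageBuildingSet hB
    have hfactors := factors_eq_of_subset (h.subset_stageBuildingSet hB.bot_notMem)
      h.Ici_subset_stageBuildingSet hxG
    rw [List.map_cons, ← hfactors]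
    refine .cons _ _ _ _ _ (hG.factors_mem_faces hbot hxG)
      (singleton_notMem_reducedNestedComplex_faces hxG) ?_
    rw [hG.stellar_reducedNestedComplex (hinsert ▸ hG') hxG htop, hinsert]
    exact ih h.of_cons

end IsPendingList

variable [Fintype L] [DecidableEq L] {B : Set L} {g : List L}

theorem isStellarSequence_of_mem_iff (hB : IsWeakBuildingSet B) (hnodup : g.Nodup)
    (hmem : ∀ x, x ∈ g ↔ x ≠ ⊥ ∧ x ≠ ⊤ ∧ x ∉ B) (horder : g.Pairwise (¬ · < ·)) :
    IsStellarSequence (reducedNestedComplex (insert ⊤ B)) (g.map fun x => (factors B x, x))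
      (orderComplex L) := by
  have hstage : stageBuildingSet g = insert ⊤ B := by
    ext x
    have hbot : x = ⊥ → x ∉ B := fun h => h ▸ hB.bot_notMem
    simp only [stageBuildingSet, Set.mem_insert_iff, Set.mem_ofPred_eq, hmem]
    tauto
  exact hstage ▸ (IsPendingList.of_mem_iff hnodup hmem horder).isStellarSequence hB

end Sequence

theorem eq_bot_of_subsingleton_Iic {α : Type*} [PartialOrder α] [OrderBot α] {a : α}
    (h : Subsingleton (Set.Iic a)) : a = ⊥ :=
  congrArg Subtype.val (h.elim ⟨a, le_rfl⟩ ⟨⊥, bot_le⟩)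

section ProductDecomposition

variable {α A B : Type*} [Lattice α] [PartialOrder A] [PartialOrder B]

theorem nonempty_boundedOrder_fst [BoundedOrder α] (e : α ≃o A × B) : Nonempty (BoundedOrder A) :=
  ⟨{ top := (e ⊤).1
     le_top := fun a => (e.symm_apply_le.1 (le_top : e.symm (a, (e ⊤).2) ≤ ⊤)).1
     bot := (e ⊥).1
     bot_le := fun a => (e.le_symm_apply.1 (bot_le : ⊥ ≤ e.symm (a, (e ⊥).2))).1 }⟩

section

variable (e : α ≃o A × B)

/-- The restriction of a product decomposition of `α` to a lower interval of `α`. -/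
def iicProdOrderIso (z : α) : Set.Iic z ≃o Set.Iic (e z).1 × Set.Iic (e z).2 where
  toFun w := (⟨(e w).1, (e.monotone w.2).1⟩, ⟨(e w).2, (e.monotone w.2).2⟩)
  invFun p := ⟨e.symm (p.1, p.2), e.symm_apply_le.2 ⟨p.1.2, p.2.2⟩⟩
  left_inv w := by simp
  right_inv p := by simp
  map_rel_iff' {v w} := e.le_iff_le

theorem symm_mk_fst_bot_of_le [OrderBot B] {u : α} {s : A} (h : u ≤ e.symm (s, ⊥)) :
    e.symm ((e u).1, ⊥) = u :=
  e.symm_apply_eq.2 (Prod.ext rfl (le_bot_iff.1 (e.le_symm_apply.1 h).2).symm)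

theorem symm_mk_bot_snd_of_le [OrderBot A] {v : α} {t : B} (h : v ≤ e.symm (⊥, t)) :
    e.symm (⊥, (e v).2) = v :=
  e.symm_apply_eq.2 (Prod.ext (le_bot_iff.1 (e.le_symm_apply.1 h).1).symm rfl)

variable [OrderBot A] [OrderBot B]

theorem symm_mk_bot_sup_symm_bot_mk (s : A) (t : B) :
    e.symm (s, ⊥) ⊔ e.symm (⊥, t) = e.symm (s, t) := by
  refine le_antisymm (sup_le (e.symm.monotone ⟨le_rfl, bot_le⟩) (e.symm.monotone ⟨bot_le, le_rfl⟩))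
    (e.symm_apply_le.2 ⟨?_, ?_⟩)
  · exact (e.symm_apply_le.1 (le_sup_left : e.symm (s, ⊥) ≤ _)).1
  · exact (e.symm_apply_le.1 (le_sup_right : e.symm (⊥, t) ≤ _)).2

theorem eq_and_eq_of_sup_eq_symm_mk {u v : α} {s : A} {t : B} (hu : u ≤ e.symm (s, ⊥))
    (hv : v ≤ e.symm (⊥, t)) (huv : u ⊔ v = e.symm (s, t)) :
    u = e.symm (s, ⊥) ∧ v = e.symm (⊥, t) := by
  rw [← symm_mk_fst_bot_of_le e hu, ← symm_mk_bot_snd_of_le e hv,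
    symm_mk_bot_sup_symm_bot_mk] at huv
  obtain ⟨hs, ht⟩ := Prod.mk.inj (e.symm.injective huv)
  rw [← symm_mk_fst_bot_of_le e hu, ← symm_mk_bot_snd_of_le e hv, hs, ht]
  exact ⟨rfl, rfl⟩

end

end ProductDecomposition

section Irreducibles

universe u

variable {L : Type u} [Lattice L] [BoundedOrder L] {x a b : L}

/-- The traces on `L` of a decomposition of `[⊥, x]` into the product of `[⊥, a]` and `[⊥, b]`, with
both factors nontrivial. -/
structure IsSplitting (x a b : L) : Prop where
  left_lt : a < x
  right_lt : b < x
  sup_eq : a ⊔ b = x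
  eq_of_sup_eq : ∀ u ≤ a, ∀ v ≤ b, u ⊔ v = x → u = a ∧ v = b
  le_or_le : ∀ z ∈ irreducibles L, z ≤ x → z ≤ a ∨ z ≤ b

theorem fst_eq_bot_or_snd_eq_bot_of_mem_irreducibles {A B : Type u} [PartialOrder A]
    [PartialOrder B] [OrderBot A] [OrderBot B] (e : Set.Iic x ≃o A × B) {z : Set.Iic x}
    (hz : (z : L) ∈ irreducibles L) : (e z).1 = ⊥ ∨ (e z).2 = ⊥ := by
  let e' : Set.Iic (z : L) ≃o Set.Iic z :=
    { toFun := fun w => ⟨⟨w, w.2.trans z.2⟩, w.2⟩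
      invFun := fun w => ⟨w, w.2⟩
      map_rel_iff' := Iff.rfl }
  exact (hz.2 _ _ ⟨e'.trans (iicProdOrderIso e z)⟩).imp eq_bot_of_subsingleton_Iic
    eq_bot_of_subsingleton_Iic

theorem isSplitting_of_orderIso_prod {A B : Type u} [PartialOrder A] [PartialOrder B]
    [BoundedOrder A] [BoundedOrder B] [Nontrivial A] [Nontrivial B] (e : Set.Iic x ≃o A × B) :
    IsSplitting x (e.symm (⊤, ⊥) : L) (e.symm (⊥, ⊤) : L) := by
  have htop : e.symm (⊤, ⊤) = ⊤ := map_top e.symm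
  have hleft : e.symm (⊤, ⊥) < ⊤ := by simp [← htop]
  have hright : e.symm (⊥, ⊤) < ⊤ := by simp [← htop]
  have hsup := (symm_mk_bot_sup_symm_bot_mk e ⊤ ⊤).trans htop
  refine ⟨hleft, hright, congrArg Subtype.val hsup, fun u hu v hv huv => ?_, fun z hz hzx => ?_⟩
  · have h := eq_and_eq_of_sup_eq_symm_mk e (u := ⟨u, hu.trans (e.symm (⊤, ⊥)).2⟩)
      (v := ⟨v, hv.trans (e.symm (⊥, ⊤)).2⟩) hu hv (Subtype.ext (by rw [htop]; exact huv))
    simpa only [Subtype.ext_iff] using h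
  · obtain h | h := fst_eq_bot_or_snd_eq_bot_of_mem_irreducibles e (z := ⟨z, hzx⟩) hz
    · exact Or.inr ((e.le_symm_apply (x := ⟨z, hzx⟩)).2 ⟨h.le, le_top⟩)
    · exact Or.inl ((e.le_symm_apply (x := ⟨z, hzx⟩)).2 ⟨le_top, h.le⟩)

theorem exists_isSplitting (hx : x ≠ ⊥) (hx' : x ∉ irreducibles L) : ∃ a b, IsSplitting x a b := by
  simp only [irreducibles, Set.mem_ofPred_eq, not_and, not_forall, not_or, exists_prop,
    not_subsingleton_iff_nontrivial] at hx'
  obtain ⟨A, B, _, _, ⟨e⟩, _, _⟩ := hx' hx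
  obtain ⟨_⟩ := nonempty_boundedOrder_fst e
  obtain ⟨_⟩ := nonempty_boundedOrder_fst (e.trans OrderIso.prodComm)
  exact ⟨_, _, isSplitting_of_orderIso_prod e⟩

variable [Fintype L]

theorem IsSplitting.sup_factors_eq {f : L → L} (h : IsSplitting x a b) (hf : ∀ y, f y ≤ y)
    (hx : (factors (irreducibles L) x).sup f = x) : (factors (irreducibles L) a).sup f = a ∧
      (factors (irreducibles L) b).sup f = b := by
  have hle (z : L) : (factors (irreducibles L) z).sup f ≤ z :=
    Finset.sup_le fun y hy => (hf y).trans (le_of_mem_factors hy)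
  refine h.eq_of_sup_eq _ (hle a) _ (hle b) (le_antisymm
    (sup_le ((hle a).trans h.left_lt.le) ((hle b).trans h.right_lt.le)) ?_)
  conv_lhs => rw [← hx]
  refine Finset.sup_le fun y hy => ?_
  obtain hya | hyb := h.le_or_le y (mem_of_mem_factors hy) (le_of_mem_factors hy)
  · exact le_sup_of_le_left (Finset.le_sup (mem_factors_of_le hy h.left_lt.le hya))
  · exact le_sup_of_le_right (Finset.le_sup (mem_factors_of_le hy h.right_lt.le hyb))

theorem isWeakBuildingSet_irreducibles : IsWeakBuildingSet (irreducibles L) where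
  bot_notMem h := h.1 rfl
  sup_factors x := by
    induction x using WellFoundedLT.induction with | ind x ih
    by_cases hx : x ∈ irreducibles L
    · rw [factors_eq_singleton hx, Finset.sup_singleton, id_eq]
    obtain rfl | hbot := eq_or_ne x ⊥
    · exact le_bot_iff.1 sup_factors_le
    obtain ⟨a, b, h⟩ := exists_isSplitting hbot hx
    refine le_antisymm sup_factors_le ?_
    calc x = a ⊔ b := h.sup_eq.symm
      _ = (factors (irreducibles L) a).sup id ⊔ (factors (irreducibles L) b).sup id := by
        rw [ih a h.left_lt, ih b h.right_lt]
      _ ≤ (factors (irreducibles L) x).sup id :=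
        sup_le (sup_factors_mono h.left_lt.le) (sup_factors_mono h.right_lt.le)
  eq_of_sup_factors_eq {f} hf {x} hsup y hy := by
    induction x using WellFoundedLT.induction with | ind x ih
    by_cases hx : x ∈ irreducibles L
    · simp only [factors_eq_singleton hx, Finset.mem_singleton, Finset.sup_singleton] at hy hsup
      rwa [hy]
    obtain rfl | hbot := eq_or_ne x ⊥
    · exact absurd (le_bot_iff.1 (le_of_mem_factors hy)) (mem_of_mem_factors hy).1
    obtain ⟨a, b, h⟩ := exists_isSplitting hbot hx
    obtain ⟨ha, hb⟩ := h.sup_factors_eq hf hsup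
    obtain hya | hyb := h.le_or_le y (mem_of_mem_factors hy) (le_of_mem_factors hy)
    · exact ih a h.left_lt ha (mem_factors_of_le hy h.left_lt.le hya)
    · exact ih b h.right_lt hb (mem_factors_of_le hy h.right_lt.le hyb)

end Irreducibles

end NestedSets

open NestedSets in
theorem mainTheorem6_general {L : Type*} [Lattice L] [BoundedOrder L] [Fintype L] [DecidableEq L]
    {B : Set L} (hB : IsWeakBuildingSet B) (g : List L) (hg_nodup : g.Nodup)
    (hg_mem : ∀ x, x ∈ g ↔ x ≠ ⊥ ∧ x ≠ ⊤ ∧ x ∉ B) (hg_order : g.Pairwise (¬ · < ·)) :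
    IsStellarSequence (reducedNestedComplex (insert ⊤ B)) (g.map fun x => (factors B x, x))
      (orderComplex L) ∧
    ∀ c, IsMaximalSimplex (orderComplex L) c →
      IsMaximalSimplex (reducedNestedComplex (insert ⊤ B)) (c.biUnion (factors B)) ∧
      IsSupportSimplex (reducedNestedComplex (insert ⊤ B))
        (subdivisionMap (g.map fun x => (factors B x, x))) c (c.biUnion (factors B)) := by
  have hseq := isStellarSequence_of_mem_iff hB hg_nodup hg_mem hg_order
  refine ⟨hseq, fun c hc => ?_⟩
  have hnotMem : ∀ x ∈ g, ∀ y ∈ g, x ∉ factors B y := fun x hx _ _ hxy =>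
    ((hg_mem x).1 hx).2.2 (mem_of_mem_factors hxy)
  have hcarrier (x) (hx : x ∈ c) : vertexCarrier (factors B) g x = factors B x := by
    by_cases hxB : x ∈ B
    · rw [vertexCarrier, factors_eq_singleton hxB, ite_self]
    · exact if_pos ((hg_mem x).2 ⟨(hc.prop.2.2 x hx).1, (hc.prop.2.2 x hx).2, hxB⟩)
  have hmax := hseq.isMaximalSimplex_biUnion hnotMem hc
  rw [Finset.biUnion_congr rfl hcarrier] at hmax
  refine ⟨hmax, isSupportSimplex_biUnion (fun x hx => ?_) (fun x hx => ?_) hmax.prop⟩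
  · rw [subdivisionMap_single hnotMem, hcarrier x hx]
  · exact hB.factors_nonempty (hc.prop.2.2 x hx).1

theorem mainTheorem6 {L : Type*} [Lattice L] [BoundedOrder L] [Fintype L] [DecidableEq L]
    [IsAtomistic L] [IsUpperModularLattice L]
    (g : List L) (hg_nodup : g.Nodup)
    (hg_mem : ∀ X : L, X ∈ g ↔ X ≠ ⊥ ∧ X ≠ ⊤ ∧ X ∉ NestedSets.irreducibles L)
    (hg_order : g.Pairwise (fun X Y => ¬ X < Y)) :
    NestedSets.IsStellarSequence
      (NestedSets.reducedNestedComplex (insert ⊤ (NestedSets.irreducibles L)))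
      (g.map (fun X => (NestedSets.factors (NestedSets.irreducibles L) X, X)))
      (NestedSets.orderComplex L) ∧
    ∀ c : Finset L, NestedSets.IsMaximalSimplex (NestedSets.orderComplex L) c →
      NestedSets.IsMaximalSimplex
        (NestedSets.reducedNestedComplex (insert ⊤ (NestedSets.irreducibles L)))
        (c.biUnion (NestedSets.factors (NestedSets.irreducibles L))) ∧
      NestedSets.IsSupportSimplex
        (NestedSets.reducedNestedComplex (insert ⊤ (NestedSets.irreducibles L)))
        (NestedSets.subdivisionMap
          (g.map (fun X => (NestedSets.factors (NestedSets.irreducibles L) X, X))))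
        c (c.biUnion (NestedSets.factors (NestedSets.irreducibles L))) :=
  mainTheorem6_general NestedSets.isWeakBuildingSet_irreducibles g hg_nodup hg_mem hg_order
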